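/- Let $K$ be an algebraically closed field of characteristic zero. Call two pairs $(p,q)$ and $(p_1,q_1)$ of monic polynomials in $K[x]$ $\infty$-equivalent if there are $a\in K^{\times}$ and $b\in K$ such that $$p_1(x)=a^{-\deg(p)}\,p(ax+b)\qquad\text{and}\qquad q_1(x)=a^{-\deg(q)}\,q(ax+b);$$ this is an equivalence relation. Let $m$ and $n$ be positive integers. Then there are only finitely many $\infty$-equivalence classes of pairs $(p,q)$ of monic polynomials in $K[x]$ such that $\deg(p)=n$, $\deg(q)=m$ and $$mp'q-npq'=\lambda\qquad\text{for some }\lambda\in K^{\times}.$$ -/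

import Mathlib

open Polynomial

/-- Pairs `(p, q)` of monic polynomials in `K[x]`. -/
abbrev MonicPair (K : Type*) [Field K] : Type _ :=
  {u : K[X] × K[X] // u.1.Monic ∧ u.2.Monic}

/-- Two pairs `(p, q)` and `(p₁, q₁)` of monic polynomials are `∞`-equivalent if there are
`a ∈ Kˣ` and `b ∈ K` such that `p₁(x) = a ^ (-deg p) p(a x + b)` and
`q₁(x) = a ^ (-deg q) q(a x + b)`. -/
def InftyEquiv {K : Type*} [Field K] (u v : MonicPair K) : Prop :=
  ∃ a b : K, a ≠ 0 ∧
    v.1.1 = C ((a ^ u.1.1.natDegree)⁻¹) * u.1.1.comp (C a * X + C b) ∧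
    v.1.2 = C ((a ^ u.1.2.natDegree)⁻¹) * u.1.2.comp (C a * X + C b)

theorem InftyEquiv.natDegree_aux {K : Type*} [Field K] {p q : K[X]} {a b : K} (ha : a ≠ 0)
    (h : q = C ((a ^ p.natDegree)⁻¹) * p.comp (C a * X + C b)) :
    q.natDegree = p.natDegree := by
  rw [h, natDegree_C_mul (inv_ne_zero (pow_ne_zero _ ha)), natDegree_comp,
    natDegree_linear ha, mul_one]

theorem InftyEquiv.symm_aux {K : Type*} [Field K] {p q : K[X]} {a b : K} (ha : a ≠ 0)
    (h : q = C ((a ^ p.natDegree)⁻¹) * p.comp (C a * X + C b)) :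
    p = C ((a⁻¹ ^ q.natDegree)⁻¹) * q.comp (C a⁻¹ * X + C (-(a⁻¹ * b))) := by
  rw [InftyEquiv.natDegree_aux ha h, h, mul_comp, C_comp, comp_assoc, ← mul_assoc, ← C_mul]
  have h1 : (C a * X + C b).comp (C a⁻¹ * X + C (-(a⁻¹ * b))) = (X : K[X]) := by
    simp only [add_comp, mul_comp, C_comp, X_comp, mul_add, ← mul_assoc, ← C_mul]
    rw [add_assoc, ← C_add]
    simp [ha]
  rw [h1, comp_X]
  simp [ha]

theorem InftyEquiv.trans_aux {K : Type*} [Field K] {p q r : K[X]} {a b c d : K} (ha : a ≠ 0)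
    (h : q = C ((a ^ p.natDegree)⁻¹) * p.comp (C a * X + C b))
    (h' : r = C ((c ^ q.natDegree)⁻¹) * q.comp (C c * X + C d)) :
    r = C (((a * c) ^ p.natDegree)⁻¹) * p.comp (C (a * c) * X + C (a * d + b)) := by
  rw [h', InftyEquiv.natDegree_aux ha h, h, mul_comp, C_comp, comp_assoc, ← mul_assoc, ← C_mul]
  have h1 : (C a * X + C b).comp (C c * X + C d) = C (a * c) * X + C (a * d + b) := by
    simp only [add_comp, mul_comp, C_comp, X_comp, C_mul, C_add]
    ring
  rw [h1, mul_pow, mul_inv, mul_comm ((c ^ p.natDegree)⁻¹)]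

/-- `∞`-equivalence is an equivalence relation on the pairs of monic polynomials. -/
def inftySetoid (K : Type*) [Field K] : Setoid (MonicPair K) where
  r := InftyEquiv
  iseqv :=
    { refl := fun _ => ⟨1, 0, one_ne_zero, by simp, by simp⟩
      symm := fun ⟨a, b, ha, h1, h2⟩ =>
        ⟨a⁻¹, -(a⁻¹ * b), inv_ne_zero ha, InftyEquiv.symm_aux ha h1, InftyEquiv.symm_aux ha h2⟩
      trans := fun ⟨a, b, ha, h1, h2⟩ ⟨c, d, hc, h3, h4⟩ =>
        ⟨a * c, a * d + b, mul_ne_zero ha hc, InftyEquiv.trans_aux ha h1 h3,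
          InftyEquiv.trans_aux ha h2 h4⟩ }

/-- The set of pairs `(p, q)` of monic polynomials with `deg p = n`, `deg q = m` such that
`m p' q - n p q'` is equal to a nonzero constant. -/
def solutionPairs (K : Type*) [Field K] (m n : ℕ) : Set (MonicPair K) :=
  {u | u.1.1.natDegree = n ∧ u.1.2.natDegree = m ∧
    ∃ c : K, c ≠ 0 ∧
      (m : K[X]) * derivative u.1.1 * u.1.2 - (n : K[X]) * u.1.1 * derivative u.1.2 = C c}

section Rigidity

variable {B : Type*} [CommRing B]

/-- If `w' P - w P'` has degree less than `deg P` while `deg w < deg P`, then `w` is constant. -/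
theorem Polynomial.eq_C_of_wronskian_coeff_eq_zero (hB : ∀ k : ℕ, k ≠ 0 → IsUnit (k : B))
    {P w : B[X]} {N : ℕ} (hPN : P.natDegree ≤ N) (hPc : P.coeff N = 1) (hw : w.degree < N)
    (h : ∀ k, N ≤ k → (derivative w * P - w * derivative P).coeff k = 0) :
    w = C (w.coeff 0) := by
  rw [eq_C_coeff_zero_iff_natDegree_eq_zero]
  by_contra hd
  rw [← natDegree_lt_iff_degree_lt (ne_zero_of_natDegree_gt (Nat.pos_of_ne_zero hd))] at hw
  obtain ⟨d, hd⟩ := Nat.exists_eq_succ_of_ne_zero hd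
  obtain ⟨M, rfl⟩ := Nat.exists_eq_succ_of_ne_zero (by omega : N ≠ 0)
  have h1 := h (d + (M + 1)) (by omega)
  have hw' : (derivative w).natDegree ≤ d := (natDegree_derivative_le _).trans (by omega)
  have hP' : (derivative P).natDegree ≤ M := (natDegree_derivative_le _).trans (by omega)
  rw [coeff_sub, coeff_mul_add_eq_of_natDegree_le hw' hPN, show d + (M + 1) = (d + 1) + M by ring,
    coeff_mul_add_eq_of_natDegree_le hd.le hP', coeff_derivative, coeff_derivative, hPc] at h1
  have h2 : ((M - d : ℕ) : B) * w.coeff (d + 1) = 0 := by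
    rw [Nat.cast_sub (by omega)]
    linear_combination -h1
  have h3 := (hB (M - d) (by omega)).mul_right_eq_zero.1 h2
  rw [← Nat.succ_eq_add_one, ← hd, coeff_natDegree, leadingCoeff_eq_zero] at h3
  simp [h3] at hd

/-- A solution of the linearisation of `m p' q - n p q' = 1` at `(p, q)` comes from a translation
of the variable. -/
theorem exists_translation_of_linearized (hB : ∀ k : ℕ, k ≠ 0 → IsUnit (k : B)) {m n : ℕ}
    (hm : m ≠ 0) (hn : n ≠ 0) {p q u v : B[X]} (hp : p.Monic) (hq : q.Monic)
    (hpn : p.natDegree = n) (hqm : q.natDegree = m) (hu : u.degree < n) (hv : v.degree < m)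
    (h : (m : B[X]) * derivative p * q - (n : B[X]) * p * derivative q = 1)
    (hlin : (m : B[X]) * (derivative u * q + derivative p * v)
      - (n : B[X]) * (u * derivative q + p * derivative v) = 0) :
    ∃ c : B, u = C c * derivative p ∧ v = C c * derivative q := by
  nontriviality B
  have hmu : IsUnit (m : B[X]) := by simpa using (hB m hm).map (C : B →+* B[X])
  have hnu : IsUnit (n : B[X]) := by simpa using (hB n hn).map (C : B →+* B[X])
  have hp' : (derivative p).degree < n := by
    rw [← hpn, ← degree_eq_natDegree hp.ne_zero]; exact degree_derivative_lt hp.ne_zero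
  have hC (b : B) (r : B[X]) : (C b * r).degree ≤ r.degree := by
    rw [← smul_eq_C_mul]; exact degree_smul_le b r
  set w : B[X] := (m : B[X]) * u * q - (n : B[X]) * p * v with hw
  have hqd : q.degree = m := by rw [degree_eq_natDegree hq.ne_zero, hqm]
  have hpd : p.degree = n := by rw [degree_eq_natDegree hp.ne_zero, hpn]
  have huq : (u * q).degree < (n + m : ℕ) := by
    rw [hq.degree_mul, hqd, Nat.cast_add]
    exact WithBot.add_lt_add_right (by simp) hu
  have hpv : (p * v).degree < (n + m : ℕ) := by
    rw [mul_comm, hp.degree_mul, hpd, Nat.cast_add, add_comm (n : WithBot ℕ)]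
    exact WithBot.add_lt_add_right (by simp) hv
  have hwd : w.degree < (n + m : ℕ) := by
    refine (degree_sub_le _ _).trans_lt (max_lt ?_ ?_)
    · rw [mul_assoc, ← C_eq_natCast]
      exact (hC _ _).trans_lt huq
    · rw [mul_assoc, ← C_eq_natCast]
      exact (hC _ _).trans_lt hpv
  have key : derivative w * (p * q) - w * derivative (p * q) = -(u * q + p * v) := by
    have hw' : derivative w = (m + n : B[X]) * (u * derivative q - derivative p * v) := by
      simp only [hw, derivative_sub, derivative_mul, derivative_natCast]
      linear_combination hlin
    rw [hw', hw, derivative_mul]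
    linear_combination -(u * q + p * v) * h
  have hwC : w = C (w.coeff 0) := by
    refine eq_C_of_wronskian_coeff_eq_zero hB (P := p * q) (N := n + m) ?_ ?_ hwd ?_
    · exact natDegree_mul_le.trans (by rw [hpn, hqm])
    · rw [coeff_mul_add_eq_of_natDegree_le hpn.le hqm.le, ← hpn, ← hqm]
      simp [hp, hq]
    · intro k hk
      rw [key]
      refine coeff_eq_zero_of_degree_lt ?_
      rw [degree_neg]
      refine ((degree_add_le _ _).trans_lt (max_lt huq hpv)).trans_le (by exact_mod_cast hk)
  set c := w.coeff 0
  have hdvd : p ∣ u - C c * derivative p := by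
    have hco : IsCoprime p ((m : B[X]) * q) :=
      ⟨-((n : B[X]) * derivative q), derivative p, by linear_combination h⟩
    refine hco.dvd_of_dvd_mul_left ⟨(n : B[X]) * (v - C c * derivative q), ?_⟩
    linear_combination hwC - C c * h
  have hu0 : u - C c * derivative p = 0 := by
    by_contra h0
    refine hp.not_dvd_of_degree_lt h0 ?_ hdvd
    rw [hpd]
    exact (degree_sub_le _ _).trans_lt (max_lt hu ((hC _ _).trans_lt hp'))
  refine ⟨c, sub_eq_zero.1 hu0, sub_eq_zero.1 ?_⟩
  have h1 : p * ((n : B[X]) * (v - C c * derivative q)) = 0 := by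
    linear_combination (m : B[X]) * q * hu0 - hwC + C c * h
  exact hnu.mul_right_eq_zero.1 (hp.mul_right_eq_zero_iff.1 h1)

/-- An infinitesimal deformation of a solution of `m p' q - n p q' = 1`, `p 0 = 0` is trivial. -/
theorem eq_of_infinitesimally_close (hB : ∀ k : ℕ, k ≠ 0 → IsUnit (k : B)) {m n : ℕ}
    (hm : m ≠ 0) (hn : n ≠ 0) {p q p₁ q₁ : B[X]} (hp : p.Monic) (hq : q.Monic)
    (hpn : p.natDegree = n) (hqm : q.natDegree = m)
    (hu : (p₁ - p).degree < n) (hv : (q₁ - q).degree < m)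
    (hp0 : p.coeff 0 = 0) (hp₁0 : p₁.coeff 0 = 0)
    (h : (m : B[X]) * derivative p * q - (n : B[X]) * p * derivative q = 1)
    (h₁ : (m : B[X]) * derivative p₁ * q₁ - (n : B[X]) * p₁ * derivative q₁ = 1)
    {I : Ideal B} (hI : I ^ 2 = ⊥) (hpI : ∀ k, (p₁ - p).coeff k ∈ I)
    (hqI : ∀ k, (q₁ - q).coeff k ∈ I) : p₁ = p ∧ q₁ = q := by
  have hmul (r s : B[X]) (hr : ∀ k, r.coeff k ∈ I) (hs : ∀ k, s.coeff k ∈ I) : r * s = 0 := by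
    ext k
    rw [coeff_mul, coeff_zero]
    refine Finset.sum_eq_zero fun x _ ↦ ?_
    rw [← Ideal.mem_bot, ← hI, sq]
    exact Ideal.mul_mem_mul (hr _) (hs _)
  have hder (r : B[X]) (hr : ∀ k, r.coeff k ∈ I) (k : ℕ) : (derivative r).coeff k ∈ I := by
    rw [coeff_derivative]
    exact I.mul_mem_right _ (hr _)
  have e1 := hmul _ _ (hder _ hpI) hqI
  have e2 := hmul _ _ hpI (hder _ hqI)
  rw [derivative_sub] at e1 e2
  obtain ⟨c, hc, hc'⟩ := exists_translation_of_linearized hB hm hn hp hq hpn hqm hu hv h (by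
    rw [derivative_sub, derivative_sub]
    linear_combination h₁ - h - (m : B[X]) * e1 + (n : B[X]) * e2)
  have hc0 : c = 0 := by
    have a1 := congr_arg (coeff · 0) hc
    have a2 := congr_arg (coeff · 0) h
    simp only [coeff_sub, hp0, hp₁0, mul_coeff_zero, coeff_one_zero, mul_zero, zero_mul, sub_zero,
      coeff_C_zero] at a1 a2
    linear_combination -c * a2 - (m : B[X]).coeff 0 * q.coeff 0 * a1
  rw [hc0, C_0, zero_mul, sub_eq_zero] at hc hc'
  exact ⟨hc, hc'⟩

end Rigidity

section Moduli

variable (K : Type*) [Field K] (m n : ℕ)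

/-- The universal monic polynomial of degree `n`, in the first half of the variables. -/
noncomputable def univLeft : (MvPolynomial (Fin n ⊕ Fin m) K)[X] :=
  (freeMonic K n).map (MvPolynomial.rename Sum.inl).toRingHom

/-- The universal monic polynomial of degree `m`, in the second half of the variables. -/
noncomputable def univRight : (MvPolynomial (Fin n ⊕ Fin m) K)[X] :=
  (freeMonic K m).map (MvPolynomial.rename Sum.inr).toRingHom

/-- The equations `p 0 = 0` and `m p' q - n p q' = 1` for a pair `(p, q)` of monic polynomials
of degrees `n` and `m`. -/
noncomputable def moduliIdeal : Ideal (MvPolynomial (Fin n ⊕ Fin m) K) :=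
  Ideal.span (insert ((univLeft K m n).coeff 0) (Set.range
    ((m : (MvPolynomial (Fin n ⊕ Fin m) K)[X]) * derivative (univLeft K m n) * univRight K m n
      - (n : (MvPolynomial (Fin n ⊕ Fin m) K)[X]) * univLeft K m n * derivative (univRight K m n)
      - 1).coeff))

/-- The coordinate ring of the scheme of pairs `(p, q)` of monic polynomials of degrees `n` and `m`
with `p 0 = 0` and `m p' q - n p q' = 1`. -/
abbrev ModuliRing : Type _ := MvPolynomial (Fin n ⊕ Fin m) K ⧸ moduliIdeal K m n

variable {K m n}
variable {B : Type*} [CommRing B] [Algebra K B]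

theorem moduliIdeal_le_ker_iff (f : MvPolynomial (Fin n ⊕ Fin m) K →ₐ[K] B) {p q : B[X]}
    (hp : (univLeft K m n).map f.toRingHom = p) (hq : (univRight K m n).map f.toRingHom = q) :
    moduliIdeal K m n ≤ RingHom.ker f ↔ p.coeff 0 = 0 ∧
      (m : B[X]) * derivative p * q - (n : B[X]) * p * derivative q = 1 := by
  subst hp hq
  rw [moduliIdeal, Ideal.span_le, Set.insert_subset_iff, Set.range_subset_iff]
  refine and_congr (by simp [coeff_map]) ?_
  rw [← sub_eq_zero, Polynomial.ext_iff]
  refine forall_congr' fun k ↦ ?_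
  rw [SetLike.mem_coe, RingHom.mem_ker, coeff_zero]
  refine Eq.congr ?_ rfl
  trans (Polynomial.map f.toRingHom ((m : (MvPolynomial (Fin n ⊕ Fin m) K)[X]) *
      derivative (univLeft K m n) * univRight K m n
      - (n : (MvPolynomial (Fin n ⊕ Fin m) K)[X]) * univLeft K m n * derivative (univRight K m n)
      - 1)).coeff k
  · rw [coeff_map]; rfl
  · simp only [Polynomial.map_sub, Polynomial.map_mul, Polynomial.map_natCast, derivative_map,
      Polynomial.map_one]

theorem univLeft_map_coeff (f : MvPolynomial (Fin n ⊕ Fin m) K →ₐ[K] B) (k : ℕ) :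
    ((univLeft K m n).map f.toRingHom).coeff k =
      if h : k < n then f (.X (Sum.inl ⟨k, h⟩)) else if k = n then 1 else 0 := by
  rw [univLeft, coeff_map, coeff_map, coeff_freeMonic]
  split_ifs <;> simp

theorem univRight_map_coeff (f : MvPolynomial (Fin n ⊕ Fin m) K →ₐ[K] B) (k : ℕ) :
    ((univRight K m n).map f.toRingHom).coeff k =
      if h : k < m then f (.X (Sum.inr ⟨k, h⟩)) else if k = m then 1 else 0 := by
  rw [univRight, coeff_map, coeff_map, coeff_freeMonic]
  split_ifs <;> simp

/-- The pair of monic polynomials that corresponds to a point of the moduli scheme. -/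
noncomputable def ModuliRing.pair (f : ModuliRing K m n →ₐ[K] B) : B[X] × B[X] :=
  ((univLeft K m n).map (f.comp (Ideal.Quotient.mkₐ K (moduliIdeal K m n))).toRingHom,
    (univRight K m n).map (f.comp (Ideal.Quotient.mkₐ K (moduliIdeal K m n))).toRingHom)

namespace ModuliRing

theorem monic_pair (f : ModuliRing K m n →ₐ[K] B) : (pair f).1.Monic ∧ (pair f).2.Monic :=
  ⟨((monic_freeMonic K n).map _).map _, ((monic_freeMonic K m).map _).map _⟩

theorem natDegree_pair [Nontrivial B] (f : ModuliRing K m n →ₐ[K] B) :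
    (pair f).1.natDegree = n ∧ (pair f).2.natDegree = m := by
  constructor
  · rw [pair, univLeft, ((monic_freeMonic K n).map _).natDegree_map,
      (monic_freeMonic K n).natDegree_map, natDegree_freeMonic]
  · rw [pair, univRight, ((monic_freeMonic K m).map _).natDegree_map,
      (monic_freeMonic K m).natDegree_map, natDegree_freeMonic]

theorem pair_equations (f : ModuliRing K m n →ₐ[K] B) : (pair f).1.coeff 0 = 0 ∧
    (m : B[X]) * derivative (pair f).1 * (pair f).2
      - (n : B[X]) * (pair f).1 * derivative (pair f).2 = 1 := by
  refine (moduliIdeal_le_ker_iff (f.comp (Ideal.Quotient.mkₐ K (moduliIdeal K m n))) rfl rfl).1 ?_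
  intro x hx
  rw [RingHom.mem_ker, AlgHom.comp_apply, Ideal.Quotient.mkₐ_eq_mk,
    Ideal.Quotient.eq_zero_iff_mem.2 hx, map_zero]

theorem coeff_pair_fst (f : ModuliRing K m n →ₐ[K] B) {k : ℕ} (hk : k < n) :
    (pair f).1.coeff k = f (Ideal.Quotient.mk _ (.X (Sum.inl ⟨k, hk⟩))) := by
  rw [pair, univLeft_map_coeff, dif_pos hk]; rfl

theorem coeff_pair_snd (f : ModuliRing K m n →ₐ[K] B) {k : ℕ} (hk : k < m) :
    (pair f).2.coeff k = f (Ideal.Quotient.mk _ (.X (Sum.inr ⟨k, hk⟩))) := by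
  rw [pair, univRight_map_coeff, dif_pos hk]; rfl

theorem pair_injective : Function.Injective (pair : (ModuliRing K m n →ₐ[K] B) → B[X] × B[X]) := by
  intro f g h
  refine Ideal.Quotient.algHom_ext _ (MvPolynomial.algHom_ext fun i ↦ ?_)
  rcases i with i | i
  · simpa [coeff_pair_fst] using congr_arg (fun x ↦ x.1.coeff i) h
  · simpa [coeff_pair_snd] using congr_arg (fun x ↦ x.2.coeff i) h

theorem exists_pair_eq {p q : B[X]} (hp : p.Monic) (hq : q.Monic) (hpn : p.natDegree = n)
    (hqm : q.natDegree = m) (hp0 : p.coeff 0 = 0)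
    (h : (m : B[X]) * derivative p * q - (n : B[X]) * p * derivative q = 1) :
    ∃ f : ModuliRing K m n →ₐ[K] B, pair f = (p, q) := by
  let g : MvPolynomial (Fin n ⊕ Fin m) K →ₐ[K] B :=
    MvPolynomial.aeval (Sum.elim (fun i ↦ p.coeff i) (fun i ↦ q.coeff i))
  have hgp : (univLeft K m n).map g.toRingHom = p := by
    ext k
    rw [univLeft_map_coeff]
    split_ifs with h1 h2
    · simp [g]
    · rw [h2, ← hpn]; exact hp.symm
    · rw [coeff_eq_zero_of_natDegree_lt (by omega)]
  have hgq : (univRight K m n).map g.toRingHom = q := by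
    ext k
    rw [univRight_map_coeff]
    split_ifs with h1 h2
    · simp [g]
    · rw [h2, ← hqm]; exact hq.symm
    · rw [coeff_eq_zero_of_natDegree_lt (by omega)]
  have hg := (moduliIdeal_le_ker_iff g hgp hgq).2 ⟨hp0, h⟩
  have hg' : ∀ x ∈ moduliIdeal K m n, g x = 0 := hg
  refine ⟨Ideal.Quotient.liftₐ _ g hg', ?_⟩
  rw [pair, Ideal.Quotient.liftₐ_comp, hgp, hgq]

theorem formallyUnramified [CharZero K] (hm : m ≠ 0) (hn : n ≠ 0) :
    Algebra.FormallyUnramified K (ModuliRing K m n) := by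
  rw [Algebra.FormallyUnramified.iff_comp_injective]
  intro R _ _ I hI f g hfg
  rcases subsingleton_or_nontrivial R with hR | hR
  · exact AlgHom.ext fun _ ↦ Subsingleton.elim _ _
  have hB (k : ℕ) (hk : k ≠ 0) : IsUnit (k : R) := by
    simpa using (Nat.cast_ne_zero.2 hk : (k : K) ≠ 0).isUnit.map (algebraMap K R)
  have hI' (x : ModuliRing K m n) : f x - g x ∈ I :=
    Ideal.Quotient.eq.1 (DFunLike.congr_fun hfg x)
  have hlt {r s : R[X]} {d : ℕ} (hr : r.Monic) (hs : s.Monic) (hrd : r.natDegree = d)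
      (hsd : s.natDegree = d) : (r - s).degree < d := by
    rw [← hrd, ← degree_eq_natDegree hr.ne_zero]
    refine degree_sub_lt_left ?_ hr.ne_zero (by rw [hr, hs])
    rw [degree_eq_natDegree hr.ne_zero, degree_eq_natDegree hs.ne_zero, hrd, hsd]
  have hu := hlt (monic_pair f).1 (monic_pair g).1 (natDegree_pair f).1 (natDegree_pair g).1
  have hv := hlt (monic_pair f).2 (monic_pair g).2 (natDegree_pair f).2 (natDegree_pair g).2
  refine pair_injective (Prod.ext_iff.2 ?_)
  refine eq_of_infinitesimally_close hB hm hn (monic_pair g).1 (monic_pair g).2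
    (natDegree_pair g).1 (natDegree_pair g).2 hu hv (pair_equations g).1 (pair_equations f).1
    (pair_equations g).2 (pair_equations f).2 hI (fun k ↦ ?_) (fun k ↦ ?_)
  · by_cases hk : k < n
    · rw [coeff_sub, coeff_pair_fst _ hk, coeff_pair_fst _ hk]
      exact hI' _
    · rw [coeff_eq_zero_of_degree_lt (hu.trans_le (by exact_mod_cast not_lt.1 hk))]
      exact I.zero_mem
  · by_cases hk : k < m
    · rw [coeff_sub, coeff_pair_snd _ hk, coeff_pair_snd _ hk]
      exact hI' _
    · rw [coeff_eq_zero_of_degree_lt (hv.trans_le (by exact_mod_cast not_lt.1 hk))]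
      exact I.zero_mem

theorem finite_points [CharZero K] (hm : m ≠ 0) (hn : n ≠ 0) :
    Finite (ModuliRing K m n →ₐ[K] K) := by
  have := formallyUnramified (K := K) hm hn
  have : Module.Finite K (ModuliRing K m n) := Algebra.FormallyUnramified.finite_of_free _ _
  exact Finite.of_fintype _

end ModuliRing

end Moduli

section Normalization

variable {K : Type*} [Field K]

theorem monic_C_mul_comp_linear {p : K[X]} (hp : p.Monic) {a : K} (ha : a ≠ 0) (b : K) :
    (C ((a ^ p.natDegree)⁻¹) * p.comp (C a * X + C b)).Monic := by
  rw [Monic, leadingCoeff_mul, leadingCoeff_C, leadingCoeff_comp (by simp [natDegree_linear ha]),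
    hp.leadingCoeff, leadingCoeff_linear ha, one_mul, inv_mul_cancel₀ (pow_ne_zero _ ha)]

theorem exists_inftyEquiv_normalized [IsAlgClosed K] {m n : ℕ} (hm : 0 < m) (hn : 0 < n)
    {u : MonicPair K} (hu : u ∈ solutionPairs K m n) :
    ∃ v : MonicPair K, InftyEquiv u v ∧ v.1.1.natDegree = n ∧ v.1.2.natDegree = m ∧
      v.1.1.coeff 0 = 0 ∧
      (m : K[X]) * derivative v.1.1 * v.1.2 - (n : K[X]) * v.1.1 * derivative v.1.2 = 1 := by
  obtain ⟨⟨p, q⟩, hp, hq⟩ := u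
  obtain ⟨hpn, hqm, l, hl, h⟩ := hu
  dsimp only at hp hq hpn hqm h
  obtain ⟨b, hb⟩ := IsAlgClosed.exists_root p (by
    rw [degree_eq_natDegree hp.ne_zero, hpn]; exact_mod_cast hn.ne')
  obtain ⟨a, ha⟩ := IsAlgClosed.exists_pow_nat_eq l (by omega : 0 < n + m - 1)
  have ha0 : a ≠ 0 := by
    rintro rfl
    rw [zero_pow (by omega)] at ha
    exact hl ha.symm
  refine ⟨⟨(C ((a ^ p.natDegree)⁻¹) * p.comp (C a * X + C b),
    C ((a ^ q.natDegree)⁻¹) * q.comp (C a * X + C b)), monic_C_mul_comp_linear hp ha0 b,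
    monic_C_mul_comp_linear hq ha0 b⟩, ⟨a, b, ha0, rfl, rfl⟩, ?_, ?_, ?_, ?_⟩
  · exact (InftyEquiv.natDegree_aux ha0 rfl).trans hpn
  · exact (InftyEquiv.natDegree_aux ha0 rfl).trans hqm
  · rw [coeff_C_mul, coeff_zero_eq_eval_zero, eval_comp]
    simp [hb.eq_zero]
  · have h' := congr_arg (fun r ↦ r.comp (C a * X + C b)) h
    simp only [sub_comp, mul_comp, natCast_comp, C_comp] at h'
    have hc : C ((a ^ n)⁻¹) * C ((a ^ m)⁻¹) * C a * C l = (1 : K[X]) := by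
      rw [← C_mul, ← C_mul, ← C_mul, ← ha, ← C_1]
      congr 1
      obtain ⟨k, rfl⟩ : ∃ k, n = k + 1 := ⟨n - 1, by omega⟩
      rw [show k + 1 + m - 1 = k + m by omega]
      field_simp
      ring
    simp only [hpn, hqm, derivative_mul, derivative_C, derivative_comp, derivative_add,
      derivative_X, zero_mul, zero_add, add_zero, mul_one]
    linear_combination C ((a ^ n)⁻¹) * C ((a ^ m)⁻¹) * C a * h' + hc

end Normalization

theorem mainTheorem9 {K : Type*} [Field K] [CharZero K] [IsAlgClosed K] (m n : ℕ)
    (hm : 0 < m) (hn : 0 < n) :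
    {c : Quotient (inftySetoid K) |
      ∃ u ∈ solutionPairs K m n, Quotient.mk (inftySetoid K) u = c}.Finite := by
  have := ModuliRing.finite_points (K := K) hm.ne' hn.ne'
  refine (Set.finite_range fun f : ModuliRing K m n →ₐ[K] K ↦
    Quotient.mk (inftySetoid K) ⟨ModuliRing.pair f, ModuliRing.monic_pair f⟩).subset ?_
  rintro _ ⟨u, hu, rfl⟩
  obtain ⟨v, huv, hvn, hvm, hv0, hv⟩ := exists_inftyEquiv_normalized hm hn hu
  obtain ⟨f, hf⟩ := ModuliRing.exists_pair_eq (K := K) v.2.1 v.2.2 hvn hvm hv0 hv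
  refine ⟨f, Eq.trans ?_ (Quotient.sound huv).symm⟩
  exact congr_arg _ (Subtype.ext hf)
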